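/- Let $\mathbb{D}\subset\mathbb{C}$ be the open unit disc with the Poincaré distance $\rho(a,b)=\tfrac12\log\frac{1+t}{1-t}$, $t=\left|\frac{a-b}{1-\bar a b}\right|$. For a domain (non-empty connected open set) $\Omega\subset\mathbb{C}^d$ and $z,w\in\Omega$ let the Kobayashi pseudodistance $\mathsf{k}_\Omega(z,w)$ be the infimum of $\sum_{j=0}^{m-1}\rho(a_j,b_j)$ over all finite chains of holomorphic maps $f_j:\mathbb{D}\to\Omega$ and points $a_j,b_j\in\mathbb{D}$ $(0\le j<m)$ that join $z$ to $w$, i.e. $f_0(a_0)=z$, $f_j(b_j)=f_{j+1}(a_{j+1})$ for $0\le j<m-1$, and $f_{m-1}(b_{m-1})=w$. The domain $\Omega$ is called Kobayashi hyperbolic if $\mathsf{k}_\Omega(z,w)=0$ implies $z=w$ for all $z,w\in\Omega$. For $x\in\partial\Omega$ (the topological boundary of $\Omega$ in $\mathbb{C}^d$), $o\in\Omega$ and $R>0$, the big horosphere with center $x$, pole $o$ and radius $R$ is \[ H^b_o(x,R)=\Big\{z\in\Omega:\ \liminf_{w\to x,\,w\in\Omega}\big(\mathsf{k}_\Omega(z,w)-\mathsf{k}_\Omega(o,w)\big)<\tfrac12\log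 R\Big\}. \] **Proposition.** Let $\Omega\subset\mathbb{C}^d$ be a Kobayashi hyperbolic convex domain and let $x\in\partial\Omega$. Then for every $R>0$ and every $o\in\Omega$, \[ x\in\overline{H^b_o(x,R)}, \] where the closure is taken in $\mathbb{C}^d$. -/

import Mathlib

open Filter Topology Metric Set

noncomputable section

namespace Kobayashi

/-- The Poincaré distance of the open unit disc of `ℂ`,
`artanh t = (1/2) log ((1 + t) / (1 - t))` with `t = |(a - b) / (1 - conj a * b)|`
(the normalization of curvature `-4`). -/
def poincareDist (a b : ℂ) : ℝ :=
  Real.artanh ‖(a - b) / (1 - (starRingEnd ℂ) a * b)‖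

variable {d : ℕ}

/-- `f` restricts to a holomorphic map from the open unit disc into `Ω`. -/
def IsAnalyticDisc (Ω : Set (EuclideanSpace ℂ (Fin d))) (f : ℂ → EuclideanSpace ℂ (Fin d)) :
    Prop :=
  DifferentiableOn ℂ f (ball 0 1) ∧ MapsTo f (ball 0 1) Ω

/-- The lengths of the chains of analytic discs of `Ω` from `z` to `w`: a chain consists of points
`z = p 0, p 1, …, p m = w`, discs `f j` and parameters `a j, b j` with `f j (a j) = p j` and
`f j (b j) = p (j + 1)` for `j < m`; its length is the sum of the Poincaré distances of `a j`
and `b j`. -/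
def chainLengths (Ω : Set (EuclideanSpace ℂ (Fin d))) (z w : EuclideanSpace ℂ (Fin d)) : Set ℝ :=
  {L | ∃ (m : ℕ) (p : ℕ → EuclideanSpace ℂ (Fin d)) (f : ℕ → ℂ → EuclideanSpace ℂ (Fin d))
      (a b : ℕ → ℂ),
      p 0 = z ∧ p m = w ∧
      (∀ j < m, IsAnalyticDisc Ω (f j) ∧ a j ∈ ball (0 : ℂ) 1 ∧ b j ∈ ball (0 : ℂ) 1 ∧
        f j (a j) = p j ∧ f j (b j) = p (j + 1)) ∧
      L = ∑ j ∈ Finset.range m, poincareDist (a j) (b j)}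

/-- The Kobayashi (pseudo)distance of `Ω`. For `Ω` open and connected and `z, w ∈ Ω` the set of
lengths is nonempty and bounded below by `0`, so that this is a true infimum. -/
def kobayashiDist (Ω : Set (EuclideanSpace ℂ (Fin d))) (z w : EuclideanSpace ℂ (Fin d)) : ℝ :=
  sInf (chainLengths Ω z w)

/-- `Ω` is Kobayashi hyperbolic: the Kobayashi pseudodistance separates the points of `Ω`. -/
def IsHyperbolic (Ω : Set (EuclideanSpace ℂ (Fin d))) : Prop :=
  ∀ z ∈ Ω, ∀ w ∈ Ω, kobayashiDist Ω z w = 0 → z = w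

/-- The big horosphere of `Ω` with center `x`, pole `o` and radius `R`. The lower limit is over
`w → x` with `w ∈ Ω` and is taken in the extended reals. -/
def bigHorosphere (Ω : Set (EuclideanSpace ℂ (Fin d))) (o x : EuclideanSpace ℂ (Fin d)) (R : ℝ) :
    Set (EuclideanSpace ℂ (Fin d)) :=
  {z | z ∈ Ω ∧
    liminf (fun w => ((kobayashiDist Ω z w - kobayashiDist Ω o w : ℝ) : EReal)) (𝓝[Ω] x) <
      (((1 / 2) * Real.log R : ℝ) : EReal)}

end Kobayashi

end

namespace Kobayashi

open ComplexConjugate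

/-! ### Harnack's inequality for holomorphic functions with positive real part -/

/-! By convexity the homothety T of center x and ratio 1/2 is a holomorphic self-map of Ω, so k(T^m
o, T^(m+n) o) ≤ a_n := k(o, T^n o). A complex supporting functional at x sends Ω into a half-plane,
where Harnack's inequality yields a_n ≥ n (log 2)/2. Linear growth forces a_(m+n) - a_n ≥ m (log
2)/4 for infinitely many n, and then w = T^(m+n) o → x gives k(T^m o, w) - k(o, w) ≤ -m (log 2)/4.
Hence T^m o lies in the horosphere for all large m, while T^m o → x. -/

theorem norm_sub_lt_norm_one_sub_conj_mul {a z : ℂ} (ha : ‖a‖ < 1) (hz : ‖z‖ < 1) :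
    ‖z - a‖ < ‖1 - conj a * z‖ := by
  have ha' : a.re * a.re + a.im * a.im < 1 := by
    rw [← Complex.normSq_apply, Complex.normSq_eq_norm_sq]
    exact pow_lt_one₀ (norm_nonneg _) ha two_ne_zero
  have hz' : z.re * z.re + z.im * z.im < 1 := by
    rw [← Complex.normSq_apply, Complex.normSq_eq_norm_sq]
    exact pow_lt_one₀ (norm_nonneg _) hz two_ne_zero
  refine lt_of_pow_lt_pow_left₀ 2 (norm_nonneg _) ?_
  rw [← Complex.normSq_eq_norm_sq, ← Complex.normSq_eq_norm_sq, Complex.normSq_apply,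
    Complex.normSq_apply]
  simp only [Complex.sub_re, Complex.sub_im, Complex.mul_re, Complex.mul_im, Complex.conj_re,
    Complex.conj_im, Complex.one_re, Complex.one_im]
  -- |1 - conj a z|² - |z - a|² = (1 - |a|²)(1 - |z|²).
  nlinarith [mul_pos (sub_pos.2 ha') (sub_pos.2 hz')]

theorem norm_moebius_lt_one {a z : ℂ} (ha : ‖a‖ < 1) (hz : ‖z‖ < 1) :
    ‖(z - a) / (1 - conj a * z)‖ < 1 := by
  have h := norm_sub_lt_norm_one_sub_conj_mul ha hz
  rw [norm_div, div_lt_one ((norm_nonneg _).trans_lt h)]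
  exact h

theorem one_sub_conj_mul_ne_zero {a z : ℂ} (ha : ‖a‖ < 1) (hz : ‖z‖ < 1) :
    1 - conj a * z ≠ 0 :=
  norm_pos_iff.1 ((norm_nonneg _).trans_lt (norm_sub_lt_norm_one_sub_conj_mul ha hz))

/-- Harnack's inequality at the center of the unit disc. -/
theorem re_zero_mul_le_re_mul {G : ℂ → ℂ} (hG : DifferentiableOn ℂ G (ball 0 1))
    (hpos : ∀ z ∈ ball (0 : ℂ) 1, 0 < (G z).re) {z : ℂ} (hz : ‖z‖ < 1) :
    (G 0).re * (1 - ‖z‖) ≤ (G z).re * (1 + ‖z‖) := by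
  have h0 : 0 < (G 0).re := hpos 0 (by simp)
  have hne : ∀ w ∈ ball (0 : ℂ) 1, G w + conj (G 0) ≠ 0 := fun w hw h => by
    have := congrArg Complex.re h
    simp only [Complex.add_re, Complex.conj_re, Complex.zero_re] at this
    linarith [hpos w hw]
  -- Schwarz lemma after the Cayley transform that takes the right half-plane to the disc and `G 0`
  -- to 0.
  have hle : ‖(G z - G 0) / (G z + conj (G 0))‖ ≤ ‖z‖ := by
    refine Complex.norm_le_norm_of_mapsTo_ball
      (f := fun w => (G w - G 0) / (G w + conj (G 0))) (R := 1)
      ((hG.sub_const _).div (hG.add_const _) hne) (fun w hw => ?_) (by simp) hz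
    rw [mem_closedBall_zero_iff, norm_div, div_le_one (norm_pos_iff.2 (hne w hw))]
    refine le_of_sq_le_sq ?_ (norm_nonneg _)
    rw [← Complex.normSq_eq_norm_sq, ← Complex.normSq_eq_norm_sq, Complex.normSq_apply,
      Complex.normSq_apply]
    simp only [Complex.sub_re, Complex.sub_im, Complex.add_re, Complex.add_im, Complex.conj_re,
      Complex.conj_im]
    nlinarith [mul_pos (hpos w hw) h0]
  have hz' : z ∈ ball (0 : ℂ) 1 := mem_ball_zero_iff.2 hz
  rw [norm_div, div_le_iff₀ (norm_pos_iff.2 (hne z hz'))] at hle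
  have hsq := pow_le_pow_left₀ (norm_nonneg _) hle 2
  rw [mul_pow, ← Complex.normSq_eq_norm_sq (G z - G 0),
    ← Complex.normSq_eq_norm_sq (G z + _), Complex.normSq_apply, Complex.normSq_apply] at hsq
  simp only [Complex.sub_re, Complex.sub_im, Complex.add_re, Complex.add_im, Complex.conj_re,
    Complex.conj_im] at hsq
  have ht : ‖z‖ ^ 2 ≤ 1 := pow_le_one₀ (norm_nonneg _) hz.le
  have hu := hpos z hz'
  -- Since ‖z‖² ≤ 1, the imaginary parts can be dropped.
  have key : ((G 0).re - (G z).re) ^ 2 ≤ (‖z‖ * ((G z).re + (G 0).re)) ^ 2 := by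
    nlinarith [mul_nonneg (sub_nonneg.2 ht) (sq_nonneg ((G z).im - (G 0).im))]
  have := abs_le_of_sq_le_sq' key (by positivity)
  linarith [this.2]

/-- Harnack's inequality in the unit disc: `1/2 * log (re F)` is `1`-Lipschitz for the Poincaré
distance. -/
theorem half_log_re_sub_le_poincareDist {F : ℂ → ℂ} (hF : DifferentiableOn ℂ F (ball 0 1))
    (hpos : ∀ z ∈ ball (0 : ℂ) 1, 0 < (F z).re) {a b : ℂ} (ha : a ∈ ball (0 : ℂ) 1)
    (hb : b ∈ ball (0 : ℂ) 1) :
    1 / 2 * (Real.log (F a).re - Real.log (F b).re) ≤ poincareDist a b := by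
  have ha' := mem_ball_zero_iff.1 ha
  have hb' := mem_ball_zero_iff.1 hb
  have hna : ‖-a‖ < 1 := by rwa [norm_neg]
  -- The disc automorphism with φ(0) = a and φ(ζ) = b reduces the claim to the center.
  set φ : ℂ → ℂ := fun z => (z - -a) / (1 - conj (-a) * z) with hφ
  set ζ : ℂ := (b - a) / (1 - conj a * b) with hζ
  have hφmaps : MapsTo φ (ball 0 1) (ball 0 1) := fun z hz =>
    mem_ball_zero_iff.2 (norm_moebius_lt_one hna (mem_ball_zero_iff.1 hz))
  have hφd : DifferentiableOn ℂ φ (ball 0 1) :=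
    (by fun_prop : DifferentiableOn ℂ (fun z : ℂ => z - -a) (ball 0 1)).div (by fun_prop)
      fun z hz => one_sub_conj_mul_ne_zero hna (mem_ball_zero_iff.1 hz)
  have hζ1 : ‖ζ‖ < 1 := norm_moebius_lt_one ha' hb'
  have hφ0 : φ 0 = a := by simp [hφ]
  have hφζ : φ ζ = b := by
    have h : ζ * (1 - conj a * b) = b - a :=
      div_mul_cancel₀ _ (one_sub_conj_mul_ne_zero ha' hb')
    simp only [hφ]
    rw [div_eq_iff (one_sub_conj_mul_ne_zero hna hζ1), map_neg]
    linear_combination h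
  have hH := re_zero_mul_le_re_mul (hF.comp hφd hφmaps) (fun z hz => hpos _ (hφmaps hz)) hζ1
  simp only [Function.comp_apply, hφ0, hφζ] at hH
  have ht : ‖(a - b) / (1 - conj a * b)‖ = ‖ζ‖ := by
    rw [hζ, norm_div, norm_div, norm_sub_rev]
  have hpa := hpos a ha
  have hpb := hpos b hb
  have hn := norm_nonneg ζ
  have h1 : 0 < 1 - ‖ζ‖ := by linarith
  rw [poincareDist, ht, Real.artanh_eq_half_log ⟨by linarith, hζ1.le⟩,
    ← Real.log_div hpa.ne' hpb.ne']
  refine mul_le_mul_of_nonneg_left (Real.log_le_log (by positivity) ?_) (by norm_num)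
  rw [div_le_div_iff₀ hpb h1]
  linarith

theorem poincareDist_nonneg (a b : ℂ) : 0 ≤ poincareDist a b := by
  unfold poincareDist
  set t := ‖(a - b) / (1 - conj a * b)‖
  have h0 : 0 ≤ t := norm_nonneg _
  rcases h0.eq_or_lt with h | h
  · rw [← h, Real.artanh_zero]
  · rcases lt_or_ge t 1 with h1 | h1
    · exact (Real.artanh_pos ⟨h, h1⟩).le
    -- `Real.artanh` takes the default value 0 on [1, ∞).
    · exact (Real.artanh_eq_zero_iff.2 (Or.inr (Or.inr h1))).ge

/-! ### The Kobayashi distance of a convex domain -/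

variable {d : ℕ} {Ω : Set (EuclideanSpace ℂ (Fin d))} {z w x o : EuclideanSpace ℂ (Fin d)}

theorem bddBelow_chainLengths : BddBelow (chainLengths Ω z w) := by
  refine ⟨0, ?_⟩
  rintro L ⟨m, p, f, a, b, -, -, -, rfl⟩
  exact Finset.sum_nonneg fun j _ => poincareDist_nonneg _ _

/-- Any two points of a convex domain are joined by a chain of analytic discs. -/
theorem chainLengths_nonempty (hopen : IsOpen Ω) (hconv : Convex ℝ Ω) (hz : z ∈ Ω) (hw : w ∈ Ω) :
    (chainLengths Ω z w).Nonempty := by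
  have hcomp : IsCompact (segment ℝ z w) := by
    rw [segment_eq_image_lineMap]
    exact isCompact_Icc.image AffineMap.lineMap_continuous
  obtain ⟨δ, hδ, hsub⟩ := hcomp.exists_thickening_subset_open hopen (hconv.segment_subset hz hw)
  obtain ⟨n, hn⟩ := exists_nat_gt (2 * ‖w - z‖ / δ)
  have hn0 : (0 : ℝ) < n := lt_of_le_of_lt (by positivity) hn
  set v : EuclideanSpace ℂ (Fin d) := (n : ℝ)⁻¹ • (w - z) with hv
  have hvδ : 2 * ‖v‖ < δ := by
    rw [div_lt_iff₀ hδ] at hn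
    rw [hv, norm_smul, Real.norm_of_nonneg (by positivity), mul_left_comm,
      inv_mul_lt_iff₀ hn0]
    exact hn
  -- Parameter 1/2 reaches the next point; the factor 2 makes the disc's radius 2‖v‖ < δ.
  refine ⟨_, n, fun j => z + (j : ℝ) • v, fun j ζ => z + (j : ℝ) • v + (2 * ζ) • v,
    fun _ => 0, fun _ => 1 / 2, by simp, ?_, fun j hj => ⟨⟨?_, ?_⟩, ?_, ?_, ?_, ?_⟩, rfl⟩
  · simp only [hv]
    rw [smul_smul, mul_inv_cancel₀ hn0.ne', one_smul, add_sub_cancel]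
  · fun_prop
  · intro ζ hζ
    refine hsub (mem_thickening_iff.2 ⟨z + (j : ℝ) • v, ?_, ?_⟩)
    · rw [segment_eq_image']
      refine ⟨(j : ℝ) * (n : ℝ)⁻¹, ⟨by positivity, ?_⟩, by simp only [hv, smul_smul]⟩
      rw [← div_eq_mul_inv, div_le_one hn0]
      exact_mod_cast hj.le
    · rw [dist_self_add_left, norm_smul, norm_mul, Complex.norm_ofNat]
      have := (mem_ball_zero_iff.1 hζ).le
      calc 2 * ‖ζ‖ * ‖v‖ ≤ 2 * 1 * ‖v‖ := by gcongr
        _ < δ := by linarith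
  · simp
  · rw [mem_ball_zero_iff]; norm_num
  · simp
  · simp [add_smul, add_assoc]

/-- A holomorphic self-map does not increase the Kobayashi distance. -/
theorem kobayashiDist_map_le {T : EuclideanSpace ℂ (Fin d) → EuclideanSpace ℂ (Fin d)}
    (hT : Differentiable ℂ T) (hmaps : MapsTo T Ω Ω) (hne : (chainLengths Ω z w).Nonempty) :
    kobayashiDist Ω (T z) (T w) ≤ kobayashiDist Ω z w := by
  refine le_csInf hne ?_
  rintro L ⟨m, p, f, a, b, h0, hm, hj, rfl⟩
  refine csInf_le bddBelow_chainLengths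
    ⟨m, fun j => T (p j), fun j => T ∘ f j, a, b, congrArg T h0, congrArg T hm, fun j hjm => ?_, rfl⟩
  obtain ⟨⟨hd, hmf⟩, ha, hb, hfa, hfb⟩ := hj j hjm
  exact ⟨⟨hT.comp_differentiableOn hd, hmaps.comp hmf⟩, ha, hb, by simp [hfa], by simp [hfb]⟩

/-- Lower bound for the Kobayashi distance of a domain contained in a half-space. -/
theorem half_log_sub_le_kobayashiDist {F : EuclideanSpace ℂ (Fin d) → ℂ}
    (hF : Differentiable ℂ F) (hpos : ∀ p ∈ Ω, 0 < (F p).re)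
    (hne : (chainLengths Ω z w).Nonempty) :
    1 / 2 * (Real.log (F z).re - Real.log (F w).re) ≤ kobayashiDist Ω z w := by
  refine le_csInf hne ?_
  rintro L ⟨m, p, f, a, b, h0, hm, hj, rfl⟩
  rw [← h0, ← hm, ← Finset.sum_range_sub' (fun j => Real.log (F (p j)).re), Finset.mul_sum]
  refine Finset.sum_le_sum fun j hjm => ?_
  obtain ⟨⟨hd, hmf⟩, ha, hb, hfa, hfb⟩ := hj j (Finset.mem_range.1 hjm)
  rw [← hfa, ← hfb]
  exact half_log_re_sub_le_poincareDist (F := F ∘ f j) (hF.comp_differentiableOn hd)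
    (fun ζ hζ => hpos _ (hmf hζ)) ha hb

/-! ### Homotheties centered at a boundary point -/

/-- The image of `z` under the homothety of center `x` and ratio `2⁻ⁿ`. -/
noncomputable def shrink (x : EuclideanSpace ℂ (Fin d)) (n : ℕ) (z : EuclideanSpace ℂ (Fin d)) :
    EuclideanSpace ℂ (Fin d) :=
  x + ((1 / 2 : ℝ) ^ n) • (z - x)

theorem differentiable_shrink (x : EuclideanSpace ℂ (Fin d)) (n : ℕ) :
    Differentiable ℂ (shrink x n) :=
  ((differentiable_id.sub_const x).const_smul ((1 / 2 : ℝ) ^ n)).const_add x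

theorem shrink_mem (hopen : IsOpen Ω) (hconv : Convex ℝ Ω) (hx : x ∈ closure Ω) (n : ℕ)
    (hz : z ∈ Ω) : shrink x n z ∈ Ω := by
  have := hconv.add_smul_sub_mem_interior' hx (hopen.interior_eq.symm ▸ hz)
    (t := (1 / 2 : ℝ) ^ n) ⟨by positivity, pow_le_one₀ (by norm_num) (by norm_num)⟩
  rwa [hopen.interior_eq] at this

theorem shrink_shrink (m n : ℕ) : shrink x m (shrink x n z) = shrink x (m + n) z := by
  simp [shrink, smul_smul, pow_add]

theorem tendsto_shrink (x z : EuclideanSpace ℂ (Fin d)) :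
    Tendsto (fun n => shrink x n z) atTop (𝓝 x) := by
  have h : Tendsto (fun n : ℕ => (1 / 2 : ℝ) ^ n) atTop (𝓝 0) :=
    tendsto_pow_atTop_nhds_zero_of_lt_one (by norm_num) (by norm_num)
  simpa [shrink] using (h.smul_const (z - x)).const_add x

/-- For a functional ℓ separating x from Ω, Re ℓ(· - x) is positive on Ω and each halving lowers its
logarithm by log 2. -/
theorem nat_mul_le_kobayashiDist_shrink (hopen : IsOpen Ω) (hconv : Convex ℝ Ω)
    (hx : x ∈ frontier Ω) (ho : o ∈ Ω) (n : ℕ) :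
    n * (Real.log 2 / 2) ≤ kobayashiDist Ω o (shrink x n o) := by
  have hx' : x ∉ Ω := by
    rw [hopen.frontier_eq] at hx
    exact hx.2
  obtain ⟨ℓ, hℓ⟩ := RCLike.geometric_hahn_banach_point_open (𝕜 := ℂ) hconv hopen hx'
  have hpos : ∀ p ∈ Ω, 0 < (ℓ (p - x)).re := fun p hp => by
    rw [map_sub, Complex.sub_re]
    exact sub_pos.2 (hℓ p hp)
  have hmem := shrink_mem hopen hconv hx.1 n ho
  refine le_trans (le_of_eq ?_) (half_log_sub_le_kobayashiDist (F := fun p => ℓ (p - x))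
    (ℓ.differentiable.comp (differentiable_id.sub_const x)) hpos
    (chainLengths_nonempty hopen hconv ho hmem))
  have hre : (ℓ (shrink x n o - x)).re = (1 / 2 : ℝ) ^ n * (ℓ (o - x)).re := by
    rw [shrink, add_sub_cancel_left, ← Complex.coe_smul, map_smul, smul_eq_mul,
      Complex.re_ofReal_mul]
  simp only [hre]
  rw [Real.log_mul (by positivity) (hpos o ho).ne', Real.log_pow, one_div, Real.log_inv]
  ring

/-- A sequence of linear growth at least `c` grows infinitely often by at least `c' * m` in `m`
steps, for every `c' < c`. -/
theorem frequently_add_le_of_linear_growth {a : ℕ → ℝ} {c c' : ℝ} (hc : c' < c)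
    (ha : ∀ n : ℕ, n * c ≤ a n) {m : ℕ} (hm : 0 < m) :
    ∃ᶠ n in atTop, a n + m * c' ≤ a (m + n) := by
  intro h
  obtain ⟨N, hN⟩ := eventually_atTop.1 h
  -- If the claim fails from N on, steps of length m keep the slope at most c' along N + km, against
  -- the lower slope c > c'.
  have hub : ∀ k : ℕ, a (N + k * m) ≤ a N + (k * m : ℕ) * c' := fun k => by
    induction k with
    | zero => simp
    | succ k ih =>
      have h1 := not_le.1 (hN (N + k * m) (by omega))
      rw [show N + (k + 1) * m = m + (N + k * m) by ring]
      push_cast at ih ⊢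
      linarith
  obtain ⟨k, hk⟩ := exists_nat_gt ((a N - N * c) / (m * (c - c')))
  have hm' : (0 : ℝ) < m * (c - c') := mul_pos (by exact_mod_cast hm) (by linarith)
  rw [div_lt_iff₀ hm'] at hk
  have h1 := hub k
  have h2 := ha (N + k * m)
  push_cast at h1 h2
  linarith

theorem shrink_mem_bigHorosphere (hopen : IsOpen Ω) (hconv : Convex ℝ Ω) (hx : x ∈ frontier Ω)
    (ho : o ∈ Ω) {R : ℝ} {m : ℕ} (hm : 0 < m) (hmR : -(m * (Real.log 2 / 4)) < 1 / 2 * Real.log R) :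
    shrink x m o ∈ bigHorosphere Ω o x R := by
  have hmem : ∀ n, shrink x n o ∈ Ω := fun n => shrink_mem hopen hconv hx.1 n ho
  refine ⟨hmem m, lt_of_le_of_lt (liminf_le_of_frequently_le' (x :=
    ((-(m * (Real.log 2 / 4)) : ℝ) : EReal)) ?_) (EReal.coe_lt_coe_iff.2 hmR)⟩
  have hlog : 0 < Real.log 2 := Real.log_pos one_lt_two
  -- Any slope strictly between 0 and (log 2)/2 would serve.
  have hfreq := frequently_add_le_of_linear_growth (c' := Real.log 2 / 4) (by linarith)
    (nat_mul_le_kobayashiDist_shrink hopen hconv hx ho) hm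
  have htend : Tendsto (fun n => shrink x (m + n) o) atTop (𝓝[Ω] x) :=
    tendsto_nhdsWithin_iff.2 ⟨(tendsto_shrink x o).comp (tendsto_add_atTop_nat m |>.congr
      fun n => add_comm n m), Eventually.of_forall fun n => hmem _⟩
  refine htend.frequently (hfreq.mono fun n hn => EReal.coe_le_coe_iff.2 ?_)
  have hcontr := kobayashiDist_map_le (differentiable_shrink x m)
    (fun p hp => shrink_mem hopen hconv hx.1 m hp)
    (chainLengths_nonempty hopen hconv ho (hmem n))
  rw [shrink_shrink] at hcontr
  linarith

end Kobayashi

theorem proposition3p5 {d : ℕ} (Ω : Set (EuclideanSpace ℂ (Fin d)))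
    (hΩ_open : IsOpen Ω) (hΩ_convex : Convex ℝ Ω) (hΩ_hyp : Kobayashi.IsHyperbolic Ω)
    (x : EuclideanSpace ℂ (Fin d)) (hx : x ∈ frontier Ω)
    (R : ℝ) (hR : 0 < R) (o : EuclideanSpace ℂ (Fin d)) (ho : o ∈ Ω) :
    x ∈ closure (Kobayashi.bigHorosphere Ω o x R) := by
  refine mem_closure_of_tendsto (Kobayashi.tendsto_shrink x o) ?_
  have hlog : 0 < Real.log 2 / 4 := div_pos (Real.log_pos one_lt_two) (by norm_num)
  have hgrow : Tendsto (fun m : ℕ => (m : ℝ) * (Real.log 2 / 4)) atTop atTop :=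
    tendsto_natCast_atTop_atTop.atTop_mul_const hlog
  filter_upwards [eventually_gt_atTop 0, hgrow.eventually_gt_atTop (-(1 / 2 * Real.log R))]
    with m hm hmR
  exact Kobayashi.shrink_mem_bigHorosphere hΩ_open hΩ_convex hx ho hm (by linarith)
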